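/- Consider the infinite path graph on $\mathbb{Z}$ (each integer $i$ is joined to $i-1$ and $i+1$ by a single edge) with one self-loop added at every vertex, and let $n$ be a natural number with $n \equiv 3 \pmod 4$. Initially $n$ chips, labeled $1, \dots, n$, are all at the origin $0$. A firing move consists of choosing three chips with labels $a < b < d$ at a common site $i$; then chip $a$ moves to site $i-1$, chip $d$ moves to site $i+1$, and chip $b$ and all other chips stay in place. A final configuration is a configuration that can be reached from the initial one by finitely many firing moves and in which no firing move is possible, i.e. no site contains three or more chips. Then the process always terminates (there is no infinite sequence of firing moves starting from the initial configuration), there is exactly one final configuration, independent of all choices of sites and chips, and it is weakly sorted: for any two chips with labels $a < b$, the final position of chip $a$ is at or to the left of the final position of chip $b$. -/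

import Mathlib

namespace SelfLoopChipFiring

/-- A configuration of `n` distinguishable chips on the sites `ℤ` of the infinite path graph:
`c i` is the site of chip `i`.  The chips are labelled by `Fin n`, with its usual linear order
(chip `i` is the chip of label `i + 1` in the labelling `1, …, n`). -/
abbrev Config (n : ℕ) : Type := Fin n → ℤ

/-- The initial configuration: all `n` chips are at the origin. -/
def initial (n : ℕ) : Config n := fun _ => 0

/-- One labelled firing move on the path graph with one self-loop at every vertex: three chips
`a < b < d` at a common site are chosen, `a` moves one step to the left, `d` moves one step to
the right, and `b` (and every other chip) stays where it is. -/
def Fires {n : ℕ} (c c' : Config n) : Prop :=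
  ∃ a b d : Fin n, a < b ∧ b < d ∧ c a = c b ∧ c b = c d ∧
    c' = Function.update (Function.update c a (c a - 1)) d (c d + 1)

/-- `c` can be reached from the initial configuration by finitely many firing moves. -/
def Reachable {n : ℕ} (c : Config n) : Prop :=
  Relation.ReflTransGen Fires (initial n) c

/-- No firing move is available at `c`. -/
def IsStable {n : ℕ} (c : Config n) : Prop :=
  ∀ c' : Config n, ¬ Fires c c'

/-- A final configuration of the process that starts with all `n` chips at the origin. -/
def IsFinal {n : ℕ} (c : Config n) : Prop :=
  Reachable c ∧ IsStable c

/-- Weakly sorted: a chip of smaller label is at or to the left of every chip of larger label. -/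
def WeaklySorted {n : ℕ} (c : Config n) : Prop :=
  ∀ a b : Fin n, a < b → c a ≤ c b

end SelfLoopChipFiring

/-! A move at `i` raises `potential univ c` by one at `i` and nowhere else, so the potential records
how often each site has fired. A least action argument bounds it by `cap`, and stability forces
equality. Hence the process terminates, and the final numbers of chips per site are fixed: for `n =
4 * m + 3`, site `i` fires `(m + 1 - |i|) ^ 2` times. Only sortedness remains, since a sorted
configuration is determined by these numbers.

For sortedness, the last `m + 1 - |i|` moves at each site form the endgame. Its moves happen at
sites with exactly three chips (`Interlaced.endFires`) and can be postponed past all others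
(`endStep_preStep_swap`), so each final configuration is reached through one with exactly these
moves left. There every site but the origin has at most two chips, and the least action bound for
the `k` smallest labels limits how many of them lie to the right of a given site. These bounds
survive the endgame (`Bounded.endStep`) and at the end exclude inversions left of the origin; mirror
symmetry handles the right side. -/

namespace SelfLoopChipFiring

open Finset

/-! ### Potentials, tails and the effect of one move -/

/-- The total distance by which the chips of `S` lie to the right of the site `i`. -/
def potential {n : ℕ} (S : Finset (Fin n)) (c : Config n) (i : ℤ) : ℤ :=
  ∑ j ∈ S, max (c j - i) 0

/-- The number of chips of `S` at or to the right of the site `e`. -/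
def tail {n : ℕ} (S : Finset (Fin n)) (c : Config n) (e : ℤ) : ℤ :=
  ∑ j ∈ S, if e ≤ c j then 1 else 0

/-- The chips of `S` at the site `i`. -/
def chipsAt {n : ℕ} (S : Finset (Fin n)) (c : Config n) (i : ℤ) : Finset (Fin n) :=
  {j ∈ S | c j = i}

/-- The chips with the `k` smallest labels. -/
def lows (n k : ℕ) : Finset (Fin n) := {j | j.1 < k}

/-- The firing move at the site `i` with the chips `a < b < d`. -/
structure FiresAt {n : ℕ} (c c' : Config n) (i : ℤ) (a b d : Fin n) : Prop where
  lt₁ : a < b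
  lt₂ : b < d
  left : c a = i
  mid : c b = i
  right : c d = i
  eq : c' = Function.update (Function.update c a (i - 1)) d (i + 1)

theorem fires_iff {n : ℕ} {c c' : Config n} :
    Fires c c' ↔ ∃ i a b d, FiresAt c c' i a b d := by
  constructor
  · rintro ⟨a, b, d, h1, h2, h3, h4, h5⟩
    exact ⟨c a, a, b, d, h1, h2, rfl, h3.symm, by rw [← h4, h3], by rw [h5, h3, h4]⟩
  · rintro ⟨i, a, b, d, h1, h2, rfl, h4, h5, h6⟩
    exact ⟨a, b, d, h1, h2, h4.symm, by rw [h4, h5], by rw [h6, h5]⟩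

theorem mem_lows {n k : ℕ} {j : Fin n} : j ∈ lows n k ↔ j.1 < k := by simp [lows]

theorem lows_self (n : ℕ) : lows n n = univ := by ext j; simp [lows]

theorem card_lows {n k : ℕ} (hk : k ≤ n) : #(lows n k) = k := by
  simp [lows, Fin.card_filter_val_lt, hk]

theorem tail_eq_potential_sub {n : ℕ} (S : Finset (Fin n)) (c : Config n) (e : ℤ) :
    tail S c e = potential S c (e - 1) - potential S c e := by
  unfold tail potential
  rw [← sum_sub_distrib]
  refine sum_congr rfl fun j _ => ?_
  split_ifs <;> omega

theorem card_chipsAt {n : ℕ} (S : Finset (Fin n)) (c : Config n) (i : ℤ) :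
    (#(chipsAt S c i) : ℤ) = tail S c i - tail S c (i + 1) := by
  unfold tail chipsAt
  rw [← sum_sub_distrib, card_filter]
  push_cast
  refine sum_congr rfl fun j _ => ?_
  split_ifs <;> omega

theorem card_chipsAt_eq_potential {n : ℕ} (S : Finset (Fin n)) (c : Config n) (i : ℤ) :
    (#(chipsAt S c i) : ℤ) =
      potential S c (i - 1) + potential S c (i + 1) - 2 * potential S c i := by
  rw [card_chipsAt, tail_eq_potential_sub, tail_eq_potential_sub, add_sub_cancel_right]
  ring

theorem tail_nonneg {n : ℕ} (S : Finset (Fin n)) (c : Config n) (e : ℤ) : 0 ≤ tail S c e :=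
  sum_nonneg fun j _ => by split_ifs <;> simp

theorem potential_nonneg {n : ℕ} (S : Finset (Fin n)) (c : Config n) (e : ℤ) :
    0 ≤ potential S c e :=
  sum_nonneg fun _ _ => le_max_right _ _

theorem tail_eq_zero {n : ℕ} {S : Finset (Fin n)} {c : Config n} {e : ℤ}
    (h : potential S c (e - 1) ≤ 0) : tail S c e = 0 := by
  have h1 := tail_eq_potential_sub S c e
  have h2 := potential_nonneg S c e
  have h3 := tail_nonneg S c e
  omega

theorem potential_initial {n : ℕ} (S : Finset (Fin n)) (i : ℤ) :
    potential S (initial n) i = #S * max (-i) 0 := by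
  simp [potential, initial]

namespace FiresAt

variable {n : ℕ} {c c' : Config n} {i : ℤ} {a b d : Fin n}

theorem sum_eq (h : FiresAt c c' i a b d) (S : Finset (Fin n)) (φ : ℤ → ℤ) :
    ∑ j ∈ S, φ (c' j) = ∑ j ∈ S, φ (c j) + (if a ∈ S then φ (i - 1) - φ i else 0) +
      (if d ∈ S then φ (i + 1) - φ i else 0) := by
  have had : a ≠ d := (h.lt₁.trans h.lt₂).ne
  have key : ∀ j, φ (c' j) = φ (c j) + (if a = j then φ (i - 1) - φ i else 0) +
      (if d = j then φ (i + 1) - φ i else 0) := by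
    intro j
    rw [h.eq]
    by_cases hd : d = j
    · subst hd; simp [had, h.right]
    · by_cases ha : a = j
      · subst ha; simp [had, had.symm, h.left]
      · simp [hd, ha, Function.update_of_ne (Ne.symm hd), Function.update_of_ne (Ne.symm ha)]
  simp only [key, sum_add_distrib, sum_ite_eq]

theorem potential_eq (h : FiresAt c c' i a b d) (S : Finset (Fin n)) (x : ℤ) :
    potential S c' x = potential S c x + (if a ∈ S ∧ x < i then -1 else 0) +
      (if d ∈ S ∧ x ≤ i then 1 else 0) := by
  unfold potential
  rw [h.sum_eq S fun y => max (y - x) 0]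
  by_cases ha : a ∈ S <;> by_cases hd : d ∈ S <;>
    simp only [ha, hd, true_and, false_and, if_true, if_false] <;> split_ifs <;> omega

theorem tail_eq (h : FiresAt c c' i a b d) (S : Finset (Fin n)) (e : ℤ) :
    tail S c' e = tail S c e + (if a ∈ S ∧ e = i then -1 else 0) +
      (if d ∈ S ∧ e = i + 1 then 1 else 0) := by
  unfold tail
  rw [h.sum_eq S fun y => if e ≤ y then 1 else 0]
  by_cases ha : a ∈ S <;> by_cases hd : d ∈ S <;>
    simp only [ha, hd, true_and, false_and, if_true, if_false] <;> split_ifs <;> omega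

/-- The contributions of the left-moving and the right-moving chip cancel at every `x ≠ i`. Thus the
full potential is its initial value plus the number of firings at `x`. -/
theorem potential_univ_eq (h : FiresAt c c' i a b d) (x : ℤ) :
    potential univ c' x = potential univ c x + if x = i then 1 else 0 := by
  rw [h.potential_eq]
  simp only [mem_univ, true_and]
  split_ifs <;> omega

theorem card_triple (h : FiresAt c c' i a b d) : #({a, b, d} : Finset (Fin n)) = 3 :=
  card_eq_three.2 ⟨a, b, d, h.lt₁.ne, (h.lt₁.trans h.lt₂).ne, h.lt₂.ne, rfl⟩

theorem triple_subset (h : FiresAt c c' i a b d) {S : Finset (Fin n)} (ha : a ∈ S) (hb : b ∈ S)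
    (hd : d ∈ S) : {a, b, d} ⊆ chipsAt S c i := by
  intro j hj
  simp only [mem_insert, mem_singleton] at hj
  rcases hj with rfl | rfl | rfl
  exacts [mem_filter.2 ⟨ha, h.left⟩, mem_filter.2 ⟨hb, h.mid⟩, mem_filter.2 ⟨hd, h.right⟩]

theorem three_le_card (h : FiresAt c c' i a b d) {S : Finset (Fin n)} (ha : a ∈ S) (hb : b ∈ S)
    (hd : d ∈ S) : 3 ≤ #(chipsAt S c i) :=
  h.card_triple ▸ card_le_card (h.triple_subset ha hb hd)

end FiresAt

theorem IsStable.card_chipsAt_le {n : ℕ} {c : Config n} (hc : IsStable c) (i : ℤ) :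
    #(chipsAt univ c i) ≤ 2 := by
  by_contra! h
  obtain ⟨t, ht, h3⟩ := exists_subset_card_eq (show 3 ≤ #(chipsAt univ c i) from h)
  have hmem : ∀ x, c (t.orderEmbOfFin h3 x) = i := fun x =>
    (mem_filter.1 (ht (t.orderEmbOfFin_mem h3 x))).2
  refine hc _ (fires_iff.2 ⟨i, t.orderEmbOfFin h3 0, t.orderEmbOfFin h3 1, t.orderEmbOfFin h3 2,
    by simp, by simp, hmem 0, hmem 1, hmem 2, rfl⟩)

/-! ### Least action bound for the smallest labels -/

/-- `⌊a² / 4⌋` for `a ≥ 0`, and `0` for `a ≤ 0`. -/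
def quarterSq (a : ℤ) : ℤ := (max a 0) ^ 2 / 4

theorem quarterSq_of_le_one {a : ℤ} (h : a ≤ 1) : quarterSq a = 0 := by
  unfold quarterSq
  obtain h | h : max a 0 = 0 ∨ max a 0 = 1 := by omega
  all_goals rw [h]; norm_num

theorem quarterSq_add_two {a : ℤ} (h : -1 ≤ a) : quarterSq (a + 2) = quarterSq a + (a + 1) := by
  obtain rfl | h := h.eq_or_lt
  · norm_num [quarterSq]
  · unfold quarterSq
    rw [max_eq_left (by omega : 0 ≤ a + 2), max_eq_left (by omega : 0 ≤ a),
      show (a + 2) ^ 2 = a ^ 2 + (a + 1) * 4 by ring, Int.add_mul_ediv_right _ _ (by norm_num)]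

theorem quarterSq_two_mul {a : ℤ} : quarterSq (2 * a) = (max a 0) ^ 2 := by
  unfold quarterSq
  rw [show max (2 * a) 0 = 2 * max a 0 by omega, mul_pow]
  norm_num

theorem quarterSq_mono : Monotone quarterSq := by
  intro a b h
  unfold quarterSq
  exact Int.ediv_le_ediv (by norm_num) (pow_le_pow_left₀ (le_max_right _ _) (max_le_max_right _ h) 2)

/-- `quarterSq` vanishes up to `1` and is strictly increasing from there on, whence the condition `2
≤ a`. -/
theorem le_of_quarterSq_le {a b : ℤ} (ha : 2 ≤ a) (h : quarterSq a ≤ quarterSq b) : a ≤ b := by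
  by_contra! hb
  have h1 : quarterSq b ≤ quarterSq (a - 1) := quarterSq_mono (by omega)
  have h2 : quarterSq (a - 1) < quarterSq a := by
    unfold quarterSq
    rw [max_eq_left (by omega : 0 ≤ a), max_eq_left (by omega : 0 ≤ a - 1)]
    obtain ⟨t, rfl | rfl⟩ := a.even_or_odd'
    · rw [show (2 * t - 1) ^ 2 = 1 + (t ^ 2 - t) * 4 by ring,
        show (2 * t) ^ 2 = 0 + t ^ 2 * 4 by ring, Int.add_mul_ediv_right _ _ (by norm_num),
        Int.add_mul_ediv_right _ _ (by norm_num)]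
      norm_num
      omega
    · rw [show (2 * t + 1 - 1) ^ 2 = 0 + t ^ 2 * 4 by ring,
        show (2 * t + 1) ^ 2 = 1 + (t ^ 2 + t) * 4 by ring, Int.add_mul_ediv_right _ _ (by norm_num),
        Int.add_mul_ediv_right _ _ (by norm_num)]
      norm_num
      omega
  omega

/-- The potential at `i` of the stabilization of `k` unlabelled chips at the origin. -/
def cap (k : ℕ) (i : ℤ) : ℤ := quarterSq ((k + 1) / 2 - 2 * |i|) + k * max (-i) 0

/-- The second difference is the number of chips at `i`, so this is stability of the configuration
with potential `cap k`. At the origin the value is `1` or `2` for `k > 0`, according to the parity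
of `k`. -/
theorem cap_second_difference (k : ℕ) (i : ℤ) :
    cap k (i - 1) + cap k (i + 1) - 2 * cap k i ≤ 2 := by
  unfold cap
  have gen : ∀ x : ℤ, quarterSq (x + 2) + quarterSq (x - 2) - 2 * quarterSq x ≤ 2 := by
    intro x
    rcases lt_or_ge x 1 with h | h
    · rw [quarterSq_of_le_one (by omega : x ≤ 1), quarterSq_of_le_one (by omega : x - 2 ≤ 1)]
      have := quarterSq_mono (by omega : x + 2 ≤ 2)
      norm_num [quarterSq] at this ⊢
      omega
    · have h1 := quarterSq_add_two (a := x) (by omega)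
      have h2 := quarterSq_add_two (a := x - 2) (by omega)
      rw [show x - 2 + 2 = x by ring] at h2
      omega
  rcases lt_trichotomy i 0 with h | rfl | h
  · rw [max_eq_left (by omega : 0 ≤ -(i - 1)), max_eq_left (by omega : 0 ≤ -(i + 1)),
      max_eq_left (by omega : 0 ≤ -i), abs_of_neg h, abs_of_neg (by omega : i - 1 < 0),
      abs_of_nonpos (by omega : i + 1 ≤ 0)]
    have := gen ((k + 1) / 2 - 2 * -i)
    rw [show ((k : ℤ) + 1) / 2 - 2 * -(i - 1) = (k + 1) / 2 - 2 * -i - 2 by ring,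
      show ((k : ℤ) + 1) / 2 - 2 * -(i + 1) = (k + 1) / 2 - 2 * -i + 2 by ring]
    linarith
  · norm_num
    rcases Nat.eq_zero_or_pos k with rfl | hk
    · norm_num [quarterSq]
    · have h2 := quarterSq_add_two (a := ((k : ℤ) + 1) / 2 - 2) (by omega)
      rw [sub_add_cancel] at h2
      omega
  · rw [max_eq_right (by omega : -(i - 1) ≤ 0), max_eq_right (by omega : -(i + 1) ≤ 0),
      max_eq_right (by omega : -i ≤ 0), abs_of_pos h, abs_of_nonneg (by omega : 0 ≤ i - 1),
      abs_of_pos (by omega : 0 < i + 1)]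
    have := gen ((k + 1) / 2 - 2 * i)
    rw [show ((k : ℤ) + 1) / 2 - 2 * (i - 1) = (k + 1) / 2 - 2 * i + 2 by ring,
      show ((k : ℤ) + 1) / 2 - 2 * (i + 1) = (k + 1) / 2 - 2 * i - 2 by ring]
    linarith

/-- If `d` is a small label, so are `a` and `b`, and the small chips make a legal move by
themselves; otherwise their potential cannot grow. In a legal move the second difference of the
potential at the site is at least `3`, that of `cap` at most `2`, and the neighbours obey the bound,
so the bound is strict at the site before the move. -/
theorem Reachable.potential_lows_le {n : ℕ} {c : Config n} (hc : Reachable c) {k : ℕ}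
    (hk : k ≤ n) : ∀ i, potential (lows n k) c i ≤ cap k i := by
  induction hc with
  | refl =>
    intro i
    rw [potential_initial, card_lows hk, cap]
    have : 0 ≤ quarterSq ((k + 1) / 2 - 2 * |i|) := Int.ediv_nonneg (sq_nonneg _) (by norm_num)
    omega
  | tail _ hf ih =>
    obtain ⟨j, a, b, d, h⟩ := fires_iff.1 hf
    intro i
    rw [h.potential_eq]
    have hda : d ∈ lows n k → a ∈ lows n k := by
      simp only [mem_lows]; have := h.lt₁; have := h.lt₂; omega
    have hdb : d ∈ lows n k → b ∈ lows n k := by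
      simp only [mem_lows]; have := h.lt₁; have := h.lt₂; omega
    have := ih i
    by_cases hd : d ∈ lows n k
    · by_cases hi : i = j
      · subst hi
        have h3 : (3 : ℤ) ≤ _ := Nat.cast_le.2 (h.three_le_card (hda hd) (hdb hd) hd)
        rw [card_chipsAt_eq_potential] at h3
        have h4 := ih (i - 1)
        have h5 := ih (i + 1)
        have h6 := cap_second_difference k i
        simp only [hd, lt_irrefl, and_false, if_false, le_refl, and_self, if_true]
        omega
      · simp only [hd, hda hd, true_and]
        split_ifs <;> omega
    · simp only [hd, false_and, if_false]
      split_ifs <;> omega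


/-! ### Remaining moves, stability and termination -/

/-- The number of firing moves at the site `i` that are still to come before `4 * m + 3` chips
that started at the origin stabilize. -/
def rem (m : ℕ) (c : Config (4 * m + 3)) (i : ℤ) : ℤ :=
  cap (4 * m + 3) i - potential univ c i

variable {m : ℕ} {c c' c'' : Config (4 * m + 3)}

theorem cap_univ (m : ℕ) (i : ℤ) :
    cap (4 * m + 3) i = (max (m + 1 - |i|) 0) ^ 2 + (4 * m + 3) * max (-i) 0 := by
  rw [cap, ← quarterSq_two_mul]
  push_cast
  congr 2
  omega

theorem cap_univ_of_le {i : ℤ} (hi : |i| ≤ m + 1) :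
    cap (4 * m + 3) i = (m + 1 - |i|) ^ 2 + (4 * m + 3) * max (-i) 0 := by
  rw [cap_univ, max_eq_left (by omega)]

theorem rem_initial (i : ℤ) : rem m (initial _) i = (max (m + 1 - |i|) 0) ^ 2 := by
  rw [rem, cap_univ, potential_initial, card_univ, Fintype.card_fin]
  push_cast
  ring

theorem Reachable.rem_nonneg (hc : Reachable c) (i : ℤ) : 0 ≤ rem m c i := by
  have := hc.potential_lows_le le_rfl i
  rw [lows_self] at this
  exact sub_nonneg.2 this

theorem FiresAt.rem_eq {i : ℤ} {a b d : Fin (4 * m + 3)} (h : FiresAt c c' i a b d) (x : ℤ) :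
    rem m c' x = rem m c x - if x = i then 1 else 0 := by
  rw [rem, rem, h.potential_univ_eq]
  ring

theorem FiresAt.rem_self {i : ℤ} {a b d : Fin (4 * m + 3)} (h : FiresAt c c' i a b d) :
    rem m c' i = rem m c i - 1 := by
  rw [h.rem_eq, if_pos rfl]

theorem FiresAt.rem_of_ne {i : ℤ} {a b d : Fin (4 * m + 3)} (h : FiresAt c c' i a b d) {x : ℤ}
    (hx : x ≠ i) : rem m c' x = rem m c x := by
  rw [h.rem_eq, if_neg hx, sub_zero]

theorem card_chipsAt_zero :
    (#(chipsAt univ c 0) : ℤ) = 1 + 2 * rem m c 0 - rem m c (-1) - rem m c 1 := by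
  have h0 := cap_univ_of_le (m := m) (i := 0) (by norm_num; omega)
  have h1 := cap_univ_of_le (m := m) (i := 1) (by norm_num)
  have h2 := cap_univ_of_le (m := m) (i := -1) (by norm_num)
  rw [card_chipsAt_eq_potential]
  unfold rem
  rw [h0, h1, h2]
  norm_num
  ring

theorem card_chipsAt_of_ne_zero {i : ℤ} (h0 : i ≠ 0) (hi : |i| ≤ m) :
    (#(chipsAt univ c i) : ℤ) = 2 + 2 * rem m c i - rem m c (i - 1) - rem m c (i + 1) := by
  have hi' := abs_le.1 hi
  rw [card_chipsAt_eq_potential]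
  unfold rem
  rw [cap_univ_of_le (i := i) (by omega),
    cap_univ_of_le (i := i - 1) (abs_le.2 ⟨by omega, by omega⟩),
    cap_univ_of_le (i := i + 1) (abs_le.2 ⟨by omega, by omega⟩)]
  rcases h0.lt_or_gt with h | h
  · rw [max_eq_left (by omega : 0 ≤ -(i - 1)), max_eq_left (by omega : 0 ≤ -(i + 1)),
      max_eq_left (by omega : 0 ≤ -i), abs_of_neg h, abs_of_neg (by omega : i - 1 < 0),
      abs_of_nonpos (by omega : i + 1 ≤ 0)]
    ring
  · rw [max_eq_right (by omega : -(i - 1) ≤ 0), max_eq_right (by omega : -(i + 1) ≤ 0),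
      max_eq_right (by omega : -i ≤ 0), abs_of_pos h, abs_of_nonneg (by omega : 0 ≤ i - 1),
      abs_of_pos (by omega : 0 < i + 1)]
    ring

theorem Reachable.fires {n : ℕ} {c c' : Config n} (hc : Reachable c) (h : Fires c c') :
    Reachable c' :=
  Relation.ReflTransGen.tail hc h

theorem Reachable.rem_antitone (h : Relation.ReflTransGen Fires c c') (x : ℤ) :
    rem m c' x ≤ rem m c x := by
  induction h with
  | refl => exact le_rfl
  | tail _ hf ih =>
    obtain ⟨i, a, b, d, h⟩ := fires_iff.1 hf
    rw [h.rem_eq]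
    split_ifs <;> omega

theorem Reachable.rem_eq_zero (hc : Reachable c) {i : ℤ} (hi : (m : ℤ) + 1 ≤ |i|) :
    rem m c i = 0 := by
  have h1 := Reachable.rem_antitone hc i
  rw [rem_initial, max_eq_right (by omega)] at h1
  have h2 := hc.rem_nonneg i
  norm_num at h1
  omega

theorem Reachable.fires_rem (hc : Reachable c) {i : ℤ} {a b d : Fin (4 * m + 3)}
    (h : FiresAt c c' i a b d) : 1 ≤ rem m c i := by
  have h1 := (hc.fires (fires_iff.2 ⟨i, a, b, d, h⟩)).rem_nonneg i
  rw [h.rem_self] at h1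
  omega

theorem Reachable.fires_site (hc : Reachable c) {i : ℤ} {a b d : Fin (4 * m + 3)}
    (h : FiresAt c c' i a b d) : |i| ≤ m := by
  by_contra! hi
  have h1 := hc.fires_rem h
  rw [hc.rem_eq_zero (by omega)] at h1
  omega

/-- A sequence that is convex at the interior points and does not start by decreasing is bounded
by its last term. -/
theorem le_of_convex {u : ℕ → ℤ} {N : ℕ} (h0 : u 0 ≤ u 1)
    (h : ∀ i, 1 ≤ i → i < N → 2 * u i ≤ u (i - 1) + u (i + 1)) :
    ∀ i, i < N → u i ≤ u (i + 1) := by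
  intro i
  induction i with
  | zero => intro _; exact h0
  | succ i ih =>
    intro hi
    have h1 := ih (by omega)
    have h2 := h (i + 1) (by omega) hi
    rw [Nat.add_sub_cancel] at h2
    omega

theorem eq_zero_of_convex {u : ℕ → ℤ} {N : ℕ} (hu : ∀ i, 0 ≤ u i) (hN : u N = 0)
    (h0 : u 0 ≤ u 1) (h : ∀ i, 1 ≤ i → i < N → 2 * u i ≤ u (i - 1) + u (i + 1)) :
    ∀ i ≤ N, u i = 0 := by
  intro i hi
  have := Nat.decreasingInduction' (P := fun j => u j ≤ 0) (m := i) (n := N)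
    (fun k hk _ ih => (le_of_convex h0 h k hk).trans ih) hi hN.le
  exact le_antisymm this (hu i)

/-- With at most two chips per site, `rem` is convex away from the origin. It is nonnegative and
vanishes at distance `m + 1`, so it is zero on any side on which it does not start by decreasing. -/
theorem IsFinal.rem_eq_zero (hc : IsFinal c) (i : ℤ) : rem m c i = 0 := by
  have hnn := hc.1.rem_nonneg
  have key : ∀ i : ℤ, i ≠ 0 → |i| ≤ m → 2 * rem m c i ≤ rem m c (i - 1) + rem m c (i + 1) := by
    intro i h0 hi
    have h1 := card_chipsAt_of_ne_zero (c := c) h0 hi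
    have h2 := hc.2.card_chipsAt_le i
    omega
  have z1 := card_chipsAt_zero (c := c)
  have z2 := hc.2.card_chipsAt_le 0
  have right : rem m c 0 ≤ rem m c 1 → ∀ i : ℕ, i ≤ m + 1 → rem m c i = 0 := fun h0 =>
    eq_zero_of_convex (u := fun i => rem m c i) (fun i => hnn i)
      (hc.1.rem_eq_zero (by push_cast; exact le_abs_self _)) h0 fun i h1 hi => by
        have := key i (by omega) (by rw [Nat.abs_cast]; omega)
        push_cast [h1]
        exact this
  have left : rem m c 0 ≤ rem m c (-1) → ∀ i : ℕ, i ≤ m + 1 → rem m c (-i) = 0 := fun h0 =>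
    eq_zero_of_convex (u := fun i => rem m c (-i)) (fun i => hnn _)
      (hc.1.rem_eq_zero (by push_cast; rw [abs_neg]; exact le_abs_self _)) (by simpa using h0)
      fun i h1 hi => by
        have := key (-i) (by omega) (by rw [abs_neg, Nat.abs_cast]; omega)
        push_cast [h1]
        rw [show -((i : ℤ) - 1) = -i + 1 by ring, show -((i : ℤ) + 1) = -i - 1 by ring]
        omega
  -- At most two chips at the origin means `2 * rem 0 ≤ rem (-1) + rem 1 + 1`; by integrality `rem`
  -- cannot decrease on both sides.
  have hr0 : rem m c 0 = 0 := by
    by_cases h : rem m c 0 ≤ rem m c 1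
    · exact_mod_cast right h 0 (by omega)
    · simpa using left (by omega) 0 (by omega)
  rcases lt_or_ge |i| (m + 1 : ℤ) with hi | hi
  · rcases le_total 0 i with h | h
    · lift i to ℕ using h
      exact right (hr0.le.trans (hnn 1)) i (by rw [Nat.abs_cast] at hi; omega)
    · obtain ⟨j, rfl⟩ : ∃ j : ℕ, i = -j := ⟨i.natAbs, by omega⟩
      exact left (hr0.le.trans (hnn (-1))) j (by rw [abs_neg, Nat.abs_cast] at hi; omega)
  · exact hc.1.rem_eq_zero hi

/-- The number of remaining firing moves at all sites that may fire. -/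
noncomputable def totalRem (m : ℕ) (c : Config (4 * m + 3)) : ℤ := ∑ i ∈ Icc (-m : ℤ) m, rem m c i

theorem Reachable.totalRem_nonneg (hc : Reachable c) : 0 ≤ totalRem m c :=
  sum_nonneg fun i _ => hc.rem_nonneg i

theorem Reachable.totalRem_fires (hc : Reachable c) (h : Fires c c') :
    totalRem m c' = totalRem m c - 1 := by
  obtain ⟨i, a, b, d, h⟩ := fires_iff.1 h
  have hi := abs_le.1 (hc.fires_site h)
  unfold totalRem
  rw [sum_congr rfl fun x _ => h.rem_eq x, sum_sub_distrib, sum_ite_eq', if_pos (mem_Icc.2 hi)]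

theorem exists_isFinal (m : ℕ) : ∃ c : Config (4 * m + 3), IsFinal c := by
  suffices h : ∀ (t : ℕ) (c : Config (4 * m + 3)), Reachable c → totalRem m c ≤ t →
      ∃ c' : Config (4 * m + 3), IsFinal c' from
    h _ _ Relation.ReflTransGen.refl (Int.self_le_toNat _)
  intro t
  induction t with
  | zero =>
    intro c hc ht
    refine ⟨c, hc, fun c' h => ?_⟩
    have h1 := hc.totalRem_fires h
    have h2 := (hc.fires h).totalRem_nonneg
    push_cast at ht
    omega
  | succ t ih =>
    intro c hc ht
    by_cases hs : IsStable c
    · exact ⟨c, hc, hs⟩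
    · unfold IsStable at hs
      push Not at hs
      obtain ⟨c', h⟩ := hs
      refine ih c' (hc.fires h) ?_
      have h1 := hc.totalRem_fires h
      push_cast at ht
      omega

theorem not_exists_infinite_run (m : ℕ) : ¬ ∃ s : ℕ → Config (4 * m + 3),
    s 0 = initial (4 * m + 3) ∧ ∀ t : ℕ, Fires (s t) (s (t + 1)) := by
  rintro ⟨s, h0, hs⟩
  have hr : ∀ t, Reachable (s t) := by
    intro t
    induction t with
    | zero => rw [h0]; exact Relation.ReflTransGen.refl
    | succ t ih => exact ih.tail (hs t)
  have hv : ∀ t : ℕ, totalRem m (s t) = totalRem m (s 0) - t := by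
    intro t
    induction t with
    | zero => simp
    | succ t ih => rw [(hr t).totalRem_fires (hs t), ih]; push_cast; ring
  have h1 := hv ((totalRem m (s 0)).toNat + 1)
  have h2 := (hr ((totalRem m (s 0)).toNat + 1)).totalRem_nonneg
  have h3 := Int.self_le_toNat (totalRem m (s 0))
  push_cast at h1
  omega


/-! ### The endgame can be postponed -/

/-- The remaining moves at `i`, truncated to the `m + 1 - |i|` moves of the endgame. -/
def endRem (m : ℕ) (c : Config (4 * m + 3)) (i : ℤ) : ℤ := min (rem m c i) (m + 1 - |i|)

/-- The truncated numbers of remaining moves drop by `0` or `1` with each step away from `0`. -/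
def Interlaced (m : ℕ) (c : Config (4 * m + 3)) : Prop :=
  ∀ i : ℤ, (0 ≤ i → i ≤ m → endRem m c i - 1 ≤ endRem m c (i + 1) ∧
      endRem m c (i + 1) ≤ endRem m c i) ∧
    (i ≤ 0 → -m ≤ i → endRem m c i - 1 ≤ endRem m c (i - 1) ∧ endRem m c (i - 1) ≤ endRem m c i)

/-- What a move of the endgame says about the neighbours of its site. -/
structure EndFires (m : ℕ) (c : Config (4 * m + 3)) (i : ℤ) : Prop where
  card : #(chipsAt univ c i) = 3
  succ : rem m c (i + 1) = if i < 0 then rem m c i else rem m c i - 1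
  pred : rem m c (i - 1) = if 0 < i then rem m c i else rem m c i - 1

theorem interlaced_initial : Interlaced m (initial _) := by
  have h : ∀ i : ℤ, |i| ≤ m + 1 → endRem m (initial _) i = m + 1 - |i| := by
    intro i hi
    rw [endRem, rem_initial, max_eq_left (by omega)]
    exact min_eq_right (by nlinarith)
  intro i
  constructor
  · intro h0 hm
    rw [h i (abs_le.2 ⟨by omega, by omega⟩), h (i + 1) (abs_le.2 ⟨by omega, by omega⟩),
      abs_of_nonneg h0, abs_of_nonneg (by omega)]
    omega
  · intro h0 hm
    rw [h i (abs_le.2 ⟨by omega, by omega⟩), h (i - 1) (abs_le.2 ⟨by omega, by omega⟩),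
      abs_of_nonpos h0, abs_of_nonpos (by omega)]
    omega

/-- Interlacing bounds the remaining moves at both neighbours from below, and the presence of three
chips bounds their sum from above by the same total. All these inequalities are therefore
equalities. -/
theorem Interlaced.endFires (hI : Interlaced m c) (hc : Reachable c) {i : ℤ}
    {a b d : Fin (4 * m + 3)} (h : FiresAt c c' i a b d) (hE : rem m c i ≤ m + 1 - |i|) :
    EndFires m c i := by
  have hi := hc.fires_site h
  have hi' := abs_le.1 hi
  have h3 := h.three_le_card (mem_univ a) (mem_univ b) (mem_univ d)
  have hmin : endRem m c i = rem m c i := min_eq_left hE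
  have hl := min_le_left (rem m c (i - 1)) (m + 1 - |i - 1|)
  have hr := min_le_left (rem m c (i + 1)) (m + 1 - |i + 1|)
  change endRem m c (i - 1) ≤ _ at hl
  change endRem m c (i + 1) ≤ _ at hr
  rcases lt_trichotomy i 0 with h0 | rfl | h0
  · have hz := card_chipsAt_of_ne_zero (c := c) h0.ne hi
    have h1 := (hI i).2 h0.le hi'.1
    have h2 := (hI (i + 1)).2 (by omega) (by omega)
    rw [add_sub_cancel_right] at h2
    refine ⟨?_, ?_, ?_⟩
    · omega
    · rw [if_pos h0]; omega
    · rw [if_neg h0.not_gt]; omega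
  · have hz := card_chipsAt_zero (c := c)
    have h1 := (hI 0).2 le_rfl (by omega)
    have h2 := (hI 0).1 le_rfl (by omega)
    norm_num at h1 h2 hl hr
    refine ⟨?_, ?_, ?_⟩
    · omega
    · norm_num; omega
    · norm_num; omega
  · have hz := card_chipsAt_of_ne_zero (c := c) h0.ne' hi
    have h1 := (hI i).1 h0.le hi'.2
    have h2 := (hI (i - 1)).1 (by omega) (by omega)
    rw [sub_add_cancel] at h2
    refine ⟨?_, ?_, ?_⟩
    · omega
    · rw [if_neg h0.not_gt]; omega
    · rw [if_pos h0]; omega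

theorem endRem_of_ne {i : ℤ} {a b d : Fin (4 * m + 3)} (h : FiresAt c c' i a b d) {x : ℤ}
    (hx : x ≠ i) : endRem m c' x = endRem m c x := by
  rw [endRem, h.rem_of_ne hx, endRem]

/-- A move before the endgame leaves `endRem` unchanged. For a move of the endgame, the exact values
at the neighbours given by `EndFires` leave room for the decrease at the site. -/
theorem Interlaced.fires (hI : Interlaced m c) (hc : Reachable c) (hf : Fires c c') :
    Interlaced m c' := by
  obtain ⟨i, a, b, d, h⟩ := fires_iff.1 hf
  have hne : ∀ x, x ≠ i → endRem m c' x = endRem m c x := fun x => endRem_of_ne h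
  have hself : endRem m c' i = min (rem m c i - 1) (m + 1 - |i|) := by rw [endRem, h.rem_self]
  have hold : endRem m c i = min (rem m c i) (m + 1 - |i|) := rfl
  by_cases hE : rem m c i ≤ m + 1 - |i|
  · have hi := abs_le.1 (hc.fires_site h)
    have hend := hI.endFires hc h hE
    have hs : endRem m c (i + 1) = min (rem m c (i + 1)) (m + 1 - |i + 1|) := rfl
    have hp : endRem m c (i - 1) = min (rem m c (i - 1)) (m + 1 - |i - 1|) := rfl
    have e1 := hend.succ
    have e2 := hend.pred
    intro x
    have hx := hI x
    rcases eq_or_ne x i with rfl | hxi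
    · rw [hne (x + 1) (by omega), hne (x - 1) (by omega)]
      constructor
      · intro h0 hm
        have h1 := hx.1 h0 hm
        rw [if_neg (by omega)] at e1
        rw [abs_of_nonneg (by omega : 0 ≤ x + 1)] at hs
        rw [abs_of_nonneg h0] at hself hold hE
        omega
      · intro h0 hm
        have h1 := hx.2 h0 hm
        rw [if_neg (by omega)] at e2
        rw [abs_of_nonpos (by omega : x - 1 ≤ 0)] at hp
        rw [abs_of_nonpos h0] at hself hold hE
        omega
    · rw [hne x hxi]
      constructor
      · intro h0 hm
        have h1 := hx.1 h0 hm
        by_cases hxs : x + 1 = i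
        · subst hxs
          rw [if_pos (by omega)] at e2
          rw [abs_of_nonneg (by omega : 0 ≤ x + 1)] at hself hold hE
          rw [add_sub_cancel_right] at e2 hp
          rw [abs_of_nonneg h0] at hp
          omega
        · rw [hne _ hxs]; exact h1
      · intro h0 hm
        have h1 := hx.2 h0 hm
        by_cases hxs : x - 1 = i
        · subst hxs
          rw [if_pos (by omega)] at e1
          rw [abs_of_nonpos (by omega : x - 1 ≤ 0)] at hself hold hE
          rw [sub_add_cancel] at e1 hs
          rw [abs_of_nonpos h0] at hs
          omega
        · rw [hne _ hxs]; exact h1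
  · have heq : ∀ x, endRem m c' x = endRem m c x := by
      intro x
      by_cases hx : x = i
      · subst hx; omega
      · exact hne x hx
    intro x
    simp only [heq]
    exact hI x

theorem Reachable.interlaced (hc : Reachable c) : Interlaced m c := by
  induction hc with
  | refl => exact interlaced_initial
  | tail hc hf ih => exact ih.fires hc hf

/-- A move before the endgame. -/
def PreStep (m : ℕ) (c c' : Config (4 * m + 3)) : Prop :=
  Reachable c ∧ ∃ i a b d, FiresAt c c' i a b d ∧ (m : ℤ) + 1 - |i| < rem m c i

/-- A move of the endgame. -/
def EndStep (m : ℕ) (c c' : Config (4 * m + 3)) : Prop :=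
  Reachable c ∧ ∃ i a b d, FiresAt c c' i a b d ∧ rem m c i ≤ m + 1 - |i|

theorem FiresAt.apply_of_ne {n : ℕ} {c c' : Config n} {i : ℤ} {a b d : Fin n}
    (h : FiresAt c c' i a b d) {j : Fin n} (hj : c j ≠ i) : c' j = c j := by
  rw [h.eq, Function.update_of_ne, Function.update_of_ne]
  · rintro rfl; exact hj h.left
  · rintro rfl; exact hj h.right

theorem FiresAt.apply_of_far {n : ℕ} {c c' : Config n} {i : ℤ} {a b d : Fin n}
    (h : FiresAt c c' i a b d) {j : Fin n} (hj : c' j ≠ i - 1) (hj' : c' j ≠ i + 1) : c' j = c j ∧ j ≠ a ∧ j ≠ d := by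
  have had : a ≠ d := (h.lt₁.trans h.lt₂).ne
  have hd : j ≠ d := by
    rintro rfl; rw [h.eq, Function.update_self] at hj'; exact hj' rfl
  have ha : j ≠ a := by
    rintro rfl
    rw [h.eq, Function.update_of_ne had, Function.update_self] at hj; exact hj rfl
  exact ⟨by rw [h.eq, Function.update_of_ne hd, Function.update_of_ne ha], ha, hd⟩

/-- Moves at sites that are not neighbours commute. -/
theorem FiresAt.comm {n : ℕ} {c c' c'' : Config n} {i i' : ℤ} {a b d a' b' d' : Fin n}
    (h : FiresAt c c' i a b d) (h' : FiresAt c' c'' i' a' b' d')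
    (h1 : i' ≠ i - 1) (h2 : i' ≠ i) (h3 : i' ≠ i + 1) :
    ∃ x, FiresAt c x i' a' b' d' ∧ FiresAt x c'' i a b d := by
  obtain ⟨ea, ha, ha'⟩ := h.apply_of_far (j := a') (by rwa [h'.left]) (by rwa [h'.left])
  obtain ⟨eb, -, -⟩ := h.apply_of_far (j := b') (by rwa [h'.mid]) (by rwa [h'.mid])
  obtain ⟨ed, hd, hd'⟩ := h.apply_of_far (j := d') (by rwa [h'.right]) (by rwa [h'.right])
  have hx : FiresAt c (Function.update (Function.update c a' (i' - 1)) d' (i' + 1)) i' a' b' d' :=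
    ⟨h'.lt₁, h'.lt₂, ea ▸ h'.left, eb ▸ h'.mid, ed ▸ h'.right, rfl⟩
  refine ⟨_, hx, h.lt₁, h.lt₂, ?_, ?_, ?_, ?_⟩
  · rw [hx.apply_of_ne (by rw [h.left]; exact h2.symm), h.left]
  · rw [hx.apply_of_ne (by rw [h.mid]; exact h2.symm), h.mid]
  · rw [hx.apply_of_ne (by rw [h.right]; exact h2.symm), h.right]
  · rw [h'.eq, h.eq, Function.update_comm ha'.symm, Function.update_comm ha.symm,
      Function.update_comm hd'.symm, Function.update_comm hd.symm]

/-- When a site makes an endgame move, `EndFires` shows that both neighbours are already in their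
endgame. A following move before the endgame is thus at a different, non-adjacent site, and the two
commute. -/
theorem endStep_preStep_swap (h : EndStep m c c') (h' : PreStep m c' c'') :
    ∃ x, PreStep m c x ∧ EndStep m x c'' := by
  obtain ⟨hc, i, a, b, d, hf, hE⟩ := h
  obtain ⟨-, j, a', b', d', hf', hP⟩ := h'
  have hend := hc.interlaced.endFires hc hf hE
  have e1 := hend.succ
  have e2 := hend.pred
  have hji : j ≠ i := by
    rintro rfl; rw [hf.rem_self] at hP; omega
  rw [hf.rem_of_ne hji] at hP
  have hj1 : j ≠ i + 1 := by
    rintro rfl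
    rcases lt_or_ge i 0 with h0 | h0
    · rw [if_pos h0] at e1
      rw [abs_of_nonpos (by omega)] at hP hE
      omega
    · rw [if_neg (by omega)] at e1
      rw [abs_of_nonneg (by omega)] at hP hE
      omega
  have hj2 : j ≠ i - 1 := by
    rintro rfl
    rcases lt_or_ge 0 i with h0 | h0
    · rw [if_pos h0] at e2
      rw [abs_of_nonneg (by omega)] at hP hE
      omega
    · rw [if_neg (by omega)] at e2
      rw [abs_of_nonpos (by omega)] at hP hE
      omega
  obtain ⟨x, hx, hx'⟩ := hf.comm hf' hj2 hji hj1
  exact ⟨x, ⟨hc, j, a', b', d', hx, hP⟩, hc.fires (fires_iff.2 ⟨_, _, _, _, hx⟩), i, a, b, d, hx',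
    by rwa [hx.rem_of_ne hji.symm]⟩

theorem preStep_of_endSteps (h : Relation.ReflTransGen (EndStep m) c c')
    (h' : PreStep m c' c'') :
    ∃ x, PreStep m c x ∧ Relation.ReflTransGen (EndStep m) x c'' := by
  induction h generalizing c'' with
  | refl => exact ⟨c'', h', Relation.ReflTransGen.refl⟩
  | tail _ hs ih =>
    obtain ⟨x, hx, hx'⟩ := endStep_preStep_swap hs h'
    obtain ⟨y, hy, hy'⟩ := ih hx
    exact ⟨y, hy, hy'.tail hx'⟩

/-- Every reachable configuration can be reached by moves before the endgame, followed by moves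
of the endgame. -/
theorem Reachable.exists_endgame (hc : Reachable c) :
    ∃ x, Relation.ReflTransGen (PreStep m) (initial _) x ∧
      Relation.ReflTransGen (EndStep m) x c := by
  induction hc with
  | refl => exact ⟨_, Relation.ReflTransGen.refl, Relation.ReflTransGen.refl⟩
  | tail hc hf ih =>
    obtain ⟨x, hx, hx'⟩ := ih
    obtain ⟨i, a, b, d, h⟩ := fires_iff.1 hf
    rcases le_or_gt (rem m _ i) (m + 1 - |i|) with hE | hP
    · exact ⟨x, hx, hx'.tail ⟨hc, i, a, b, d, h, hE⟩⟩
    · obtain ⟨y, hy, hy'⟩ := preStep_of_endSteps hx' ⟨hc, i, a, b, d, h, hP⟩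
      exact ⟨y, hx.tail hy, hy'⟩

theorem reachable_of_preSteps (h : Relation.ReflTransGen (PreStep m) (initial _) c) :
    Reachable c := by
  refine Relation.ReflTransGen.mono ?_ _ _ h
  rintro _ _ ⟨-, i, a, b, d, hf, -⟩
  exact fires_iff.2 ⟨i, a, b, d, hf⟩

theorem le_rem_of_preSteps (h : Relation.ReflTransGen (PreStep m) (initial _) c) (i : ℤ) :
    (m : ℤ) + 1 - |i| ≤ rem m c i := by
  induction h with
  | refl =>
    rw [rem_initial]
    have := le_max_left ((m : ℤ) + 1 - |i|) 0
    have := le_max_right ((m : ℤ) + 1 - |i|) 0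
    rcases this.eq_or_lt with h | h
    · rw [← h]; omega
    · nlinarith
  | tail _ hs ih =>
    obtain ⟨-, j, a, b, d, hf, hP⟩ := hs
    rw [hf.rem_eq]
    split_ifs with hij
    · subst hij; omega
    · omega

theorem rem_of_endSteps (h : Relation.ReflTransGen (EndStep m) c c') {i : ℤ}
    (hi : (m : ℤ) + 1 - |i| < rem m c i) : rem m c' i = rem m c i := by
  induction h with
  | refl => rfl
  | tail _ hs ih =>
    obtain ⟨-, j, a, b, d, hf, hE⟩ := hs
    rw [hf.rem_of_ne, ih]
    rintro rfl
    omega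

/-- Every final configuration can be reached through the configuration with
`m + 1 - |i|` remaining moves at each site `i`. -/
theorem IsFinal.exists_endgame (hc : IsFinal c) :
    ∃ x, Reachable x ∧ (∀ i : ℤ, |i| ≤ m + 1 → rem m x i = m + 1 - |i|) ∧
      Relation.ReflTransGen (EndStep m) x c := by
  obtain ⟨x, hx, hx'⟩ := hc.1.exists_endgame
  refine ⟨x, reachable_of_preSteps hx, fun i hi => ?_, hx'⟩
  -- Endgame moves never touch a site with too many moves left, so a strict inequality would leave a
  -- positive remainder in the final configuration.
  rcases (le_rem_of_preSteps hx i).eq_or_lt with h | h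
  · exact h.symm
  · have h1 := rem_of_endSteps hx' h
    rw [hc.rem_eq_zero] at h1
    omega


/-! ### Mirror symmetry and the start of the endgame -/

/-- The mirror image of a configuration, with the order of the labels reversed. -/
def reflect {n : ℕ} (c : Config n) : Config n := fun j => -c j.rev

theorem FiresAt.reflect {n : ℕ} {c c' : Config n} {i : ℤ} {a b d : Fin n}
    (h : FiresAt c c' i a b d) :
    FiresAt (reflect c) (reflect c') (-i) d.rev b.rev a.rev := by
  have had : a ≠ d := (h.lt₁.trans h.lt₂).ne
  refine ⟨Fin.rev_lt_rev.2 h.lt₂, Fin.rev_lt_rev.2 h.lt₁, ?_, ?_, ?_, ?_⟩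
  · simp [SelfLoopChipFiring.reflect, h.right]
  · simp [SelfLoopChipFiring.reflect, h.mid]
  · simp [SelfLoopChipFiring.reflect, h.left]
  · ext j
    rw [h.eq]
    by_cases ha : j = a.rev
    · subst ha
      simp [SelfLoopChipFiring.reflect, had]
      ring
    · have ha' : j.rev ≠ a := fun e => ha (by rw [← e, Fin.rev_rev])
      by_cases hd : j = d.rev
      · subst hd
        simp [SelfLoopChipFiring.reflect, had.symm]
        ring
      · have hd' : j.rev ≠ d := fun e => hd (by rw [← e, Fin.rev_rev])
        simp [SelfLoopChipFiring.reflect, ha, hd, ha', hd']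

theorem reflect_reflect {n : ℕ} (c : Config n) : reflect (reflect c) = c := by
  ext j
  simp [reflect]

theorem Fires.reflect {n : ℕ} {c c' : Config n} (h : Fires c c') :
    Fires (reflect c) (reflect c') := by
  obtain ⟨i, a, b, d, h⟩ := fires_iff.1 h
  exact fires_iff.2 ⟨_, _, _, _, h.reflect⟩

theorem Reachable.reflect {n : ℕ} {c : Config n} (hc : Reachable c) :
    Reachable (reflect c) := by
  induction hc with
  | refl =>
    have : SelfLoopChipFiring.reflect (initial n) = initial n := by
      ext j; simp [SelfLoopChipFiring.reflect, initial]
    rw [this]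
    exact Relation.ReflTransGen.refl
  | tail _ hf ih => exact ih.fires hf.reflect

theorem IsFinal.reflect {n : ℕ} {c : Config n} (hc : IsFinal c) : IsFinal (reflect c) := by
  refine ⟨hc.1.reflect, fun c' h => hc.2 (SelfLoopChipFiring.reflect c') ?_⟩
  have := h.reflect
  rwa [reflect_reflect] at this

/-- The chips of small labels at or to the right of `e`, in terms of the chips of large labels to
the left of `e`. -/
theorem tail_lows_eq {n k : ℕ} (hk : k ≤ n) (c : Config n) (e : ℤ) :
    tail (lows n k) c e =
      k - n + tail univ c e + tail (lows n (n - k)) (reflect c) (1 - e) := by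
  have h1 : tail (lows n (n - k)) (reflect c) (1 - e) =
      ∑ j ∈ (lows n k)ᶜ, (1 - if e ≤ c j then 1 else 0) := by
    unfold tail reflect
    refine sum_nbij' Fin.rev Fin.rev ?_ ?_ (by simp) (by simp) ?_
    · intro j hj
      simp only [mem_compl, mem_lows, Fin.val_rev] at hj ⊢
      omega
    · intro j hj
      simp only [mem_compl, mem_lows, Fin.val_rev] at hj ⊢
      omega
    · intro j _
      split_ifs <;> omega
  have h2 : tail univ c e =
      tail (lows n k) c e + ∑ j ∈ (lows n k)ᶜ, if e ≤ c j then 1 else 0 :=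
    (sum_add_sum_compl _ _).symm
  rw [h1, h2, sum_sub_distrib, sum_const, card_compl, card_lows hk, Fintype.card_fin]
  rw [nsmul_one, Nat.cast_sub hk]
  ring

theorem chipsAt_subset {n : ℕ} (S : Finset (Fin n)) (c : Config n) (i : ℤ) :
    chipsAt S c i ⊆ chipsAt univ c i :=
  filter_subset_filter _ (subset_univ S)

/-- With at most two chips per site, `T` chips at or beyond `e` have total distance at least `T + (T
- 2) + ⋯ = quarterSq (T + 1)` from `e - 1`. The induction runs from far right, where there are no
small chips, towards the origin. -/
theorem Reachable.quarterSq_tail_le {n k : ℕ} {c : Config n} (hc : Reachable c) (hk : k ≤ n)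
    (h2 : ∀ i, 1 ≤ i → #(chipsAt univ c i) ≤ 2) :
    ∀ (t : ℕ) (e : ℤ), 1 ≤ e → (k : ℤ) + 1 ≤ e + t →
      quarterSq (tail (lows n k) c e + 1) ≤ potential (lows n k) c (e - 1) := by
  intro t
  induction t with
  | zero =>
    intro e he ht
    have h := hc.potential_lows_le hk (e - 1)
    rw [cap, abs_of_nonneg (by omega), max_eq_right (by omega),
      quarterSq_of_le_one (by omega)] at h
    rw [tail_eq_zero (by omega), quarterSq_of_le_one (by omega)]
    exact potential_nonneg _ _ _
  | succ t ih =>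
    intro e he ht
    have h3 := ih (e + 1) (by omega) (by push_cast at ht; omega)
    rw [add_sub_cancel_right] at h3
    have h4 := card_chipsAt (lows n k) c e
    have h5 := (card_le_card (chipsAt_subset (lows n k) c e)).trans (h2 e he)
    have h6 := tail_eq_potential_sub (lows n k) c e
    have h7 := quarterSq_add_two (a := tail (lows n k) c e - 1)
      (by have := tail_nonneg (lows n k) c e; omega)
    rw [show tail (lows n k) c e - 1 + 2 = tail (lows n k) c e + 1 by ring] at h7
    have h8 : quarterSq (tail (lows n k) c e - 1) ≤ quarterSq (tail (lows n k) c (e + 1) + 1) :=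
      quarterSq_mono (by omega)
    omega

/-- This compares the packing bound below with the least action bound above. The case of no chips is
separate because `quarterSq` is not injective on small arguments. -/
theorem Reachable.tail_lows_le {n k : ℕ} {c : Config n} (hc : Reachable c) (hk : k ≤ n)
    (h2 : ∀ i, 1 ≤ i → #(chipsAt univ c i) ≤ 2) {e : ℤ} (he : 1 ≤ e) :
    tail (lows n k) c e = 0 ∨ tail (lows n k) c e ≤ ((k : ℤ) + 1) / 2 - 2 * e + 1 := by
  rcases (tail_nonneg (lows n k) c e).eq_or_lt with h | h
  · exact Or.inl h.symm
  · right
    have h3 := (hc.quarterSq_tail_le hk h2 (k + 1) e he (by push_cast; omega)).trans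
      (hc.potential_lows_le hk (e - 1))
    rw [cap, abs_of_nonneg (by omega), max_eq_right (by omega), mul_zero, add_zero] at h3
    have := le_of_quarterSq_le (by omega) h3
    omega

theorem card_chipsAt_le_rem (c : Config (4 * m + 3)) (i : ℤ) :
    (#(chipsAt univ c i) : ℤ) ≤ 2 + 2 * rem m c i - rem m c (i - 1) - rem m c (i + 1) := by
  rw [card_chipsAt_eq_potential]
  have := cap_second_difference (4 * m + 3) i
  unfold rem
  omega

theorem tail_univ_eq {e : ℤ} (he : -m ≤ e) (he' : e ≤ 0) :
    tail univ c e = 4 * m + 3 - 2 * (m + e) - 1 - rem m c (e - 1) + rem m c e := by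
  rw [tail_eq_potential_sub]
  unfold rem
  rw [cap_univ_of_le (i := e) (abs_le.2 ⟨by omega, by omega⟩),
    cap_univ_of_le (i := e - 1) (abs_le.2 ⟨by omega, by omega⟩), abs_of_nonpos he',
    abs_of_nonpos (by omega), max_eq_left (by omega), max_eq_left (by omega)]
  ring

/-! ### Bounds on small labels throughout the endgame -/

/-- The bound for the number of the `k` smallest chips at or to the right of `e` in the endgame,
when there are `r` moves left at `e`. -/
def tailBound (m k : ℕ) (r e : ℤ) : ℤ :=
  max (max (r - (m + min e 0) + k / 2) (r + k - 1 - 2 * (m + min e 0))) 0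

/-- The bound on the positions of the `k` smallest chips that holds throughout the endgame. -/
def Bounded (m k : ℕ) (c : Config (4 * m + 3)) : Prop :=
  ∀ e : ℤ, -m ≤ e → e ≤ m + 1 → tail (lows (4 * m + 3) k) c e ≤ tailBound m k (rem m c e) e

theorem card_chipsAt_reflect {n : ℕ} (c : Config n) (i : ℤ) :
    #(chipsAt univ (reflect c) i) = #(chipsAt univ c (-i)) := by
  refine card_nbij' Fin.rev Fin.rev ?_ ?_ (fun j _ => Fin.rev_rev j)
    (fun j _ => Fin.rev_rev j) <;> intro j <;> simp [chipsAt, reflect, neg_eq_iff_eq_neg]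

theorem Reachable.bounded (hc : Reachable c)
    (hr : ∀ i : ℤ, |i| ≤ m + 1 → rem m c i = m + 1 - |i|) {k : ℕ} (hk : k ≤ 2 * m + 1) :
    Bounded m k c := by
  -- Here `rem` is linear on each side between the origin and distance `m + 1`, which leaves at most
  -- two chips at each nonzero site.
  have h2 : ∀ i, i ≠ 0 → #(chipsAt univ c i) ≤ 2 := by
    intro i h0
    have h := card_chipsAt_le_rem c i
    have h1 := hc.rem_nonneg (i - 1)
    have h3 := hc.rem_nonneg (i + 1)
    rcases lt_or_ge |i| (m + 1 : ℤ) with hi | hi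
    · have hi' := abs_lt.1 hi
      rw [hr i hi.le, hr _ (abs_le.2 ⟨by omega, by omega⟩), hr _ (abs_le.2 ⟨by omega, by omega⟩)]
        at h
      rcases h0.lt_or_gt with h0 | h0
      · rw [abs_of_neg h0, abs_of_neg (by omega), abs_of_nonpos (by omega)] at h
        omega
      · rw [abs_of_pos h0, abs_of_nonneg (by omega), abs_of_pos (by omega)] at h
        omega
    · rw [hc.rem_eq_zero hi] at h
      omega
  intro e he he'
  rw [hr e (abs_le.2 ⟨by omega, by omega⟩), tailBound]
  rcases le_or_gt e 0 with h0 | h0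
  -- Left of the origin, the small chips are counted through the `4 * m + 3 - k` largest ones, whose
  -- mirror images lie to the right.
  · have h3 := tail_lows_eq (by omega : k ≤ 4 * m + 3) c e
    have h4 := hc.reflect.tail_lows_le (by omega : 4 * m + 3 - k ≤ 4 * m + 3)
      (fun i hi => by rw [card_chipsAt_reflect]; exact h2 _ (by omega)) (e := 1 - e) (by omega)
    rw [tail_univ_eq he h0, hr e (abs_le.2 ⟨by omega, by omega⟩),
      hr (e - 1) (abs_le.2 ⟨by omega, by omega⟩), abs_of_nonpos h0,
      abs_of_nonpos (by omega : e - 1 ≤ 0)] at h3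
    rw [abs_of_nonpos h0, min_eq_left h0]
    push_cast at h3
    rcases h4 with h4 | h4 <;> omega
  · have h3 := hc.tail_lows_le (by omega : k ≤ 4 * m + 3) (fun i hi => h2 _ (by omega))
      (e := e) (by omega)
    rw [abs_of_pos h0, min_eq_right h0.le]
    omega

/-- A move at a site with exactly three chips bounds the numbers of small chips beyond that site
in a max-plus linear way. -/
theorem FiresAt.tail_lows_le {n : ℕ} {c c' : Config n} {i : ℤ} {a b d : Fin n}
    (h : FiresAt c c' i a b d) (h3 : #(chipsAt univ c i) = 3) (k : ℕ) :
    tail (lows n k) c' i ≤ max (tail (lows n k) c i - 1) (tail (lows n k) c (i + 1)) ∧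
      tail (lows n k) c' (i + 1) ≤
        max (tail (lows n k) c (i + 1)) (tail (lows n k) c i - 2) := by
  have hab : b ∈ lows n k → a ∈ lows n k := by
    simp only [mem_lows]; have := h.lt₁; omega
  have hbd : d ∈ lows n k → b ∈ lows n k := by
    simp only [mem_lows]; have := h.lt₂; omega
  have htriple : {a, b, d} = chipsAt univ c i :=
    eq_of_subset_of_card_le (h.triple_subset (mem_univ a) (mem_univ b) (mem_univ d))
      (by rw [h3, h.card_triple])
  have hz := card_chipsAt (lows n k) c i
  have hi := h.tail_eq (lows n k) i
  have hi' := h.tail_eq (lows n k) (i + 1)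
  -- The small labels among `a < b < d` form an initial segment. With three of them both ends move,
  -- with one or two only `a` does, and with none the two tails agree and stay fixed.
  by_cases hd : d ∈ lows n k
  · have h4 := h.three_le_card (hab (hbd hd)) (hbd hd) hd
    simp [hd, hab (hbd hd)] at hi hi'
    omega
  · by_cases ha : a ∈ lows n k
    · simp [hd, ha] at hi hi'
      omega
    · have hempty : chipsAt (lows n k) c i = ∅ := by
        refine eq_empty_of_forall_notMem fun j hj => ?_
        have hj' := chipsAt_subset _ _ _ hj
        rw [← htriple] at hj'
        simp only [mem_insert, mem_singleton] at hj'
        have hjS := (mem_filter.1 hj).1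
        rcases hj' with rfl | rfl | rfl
        exacts [ha hjS, ha (hab hjS), hd hjS]
      rw [hempty, card_empty] at hz
      simp [hd, ha] at hi hi'
      omega

/-- `tailBound` is compatible with the max-plus inequalities of a move. For `i < 0` both sites have
the same `r`, and the two nonconstant terms drop by `1` and `2` from `i` to `i + 1`. For `0 ≤ i` the
bound depends on the site only through `r`, which drops by `1`. -/
theorem Bounded.endStep {k : ℕ} (hk : k ≤ 2 * m + 1) (hB : Bounded m k c)
    (h : EndStep m c c') : Bounded m k c' := by
  obtain ⟨hc, i, a, b, d, hf, hE⟩ := h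
  have hend := hc.interlaced.endFires hc hf hE
  have hi := abs_le.1 (hc.fires_site hf)
  have e1 := hend.succ
  obtain ⟨t1, t2⟩ := hf.tail_lows_le hend.card k
  have b1 := hB i (by omega) (by omega)
  have b2 := hB (i + 1) (by omega) (by omega)
  unfold tailBound at b1 b2
  intro e he he'
  unfold tailBound
  by_cases h1 : e = i
  · subst h1
    rw [hf.rem_self]
    rcases lt_or_ge e 0 with h0 | h0
    · rw [if_pos h0] at e1
      omega
    · rw [if_neg (by omega)] at e1
      omega
  · rw [hf.rem_of_ne h1]
    by_cases h2 : e = i + 1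
    · subst h2
      rcases lt_or_ge i 0 with h0 | h0
      · rw [if_pos h0] at e1
        omega
      · rw [if_neg (by omega)] at e1
        omega
    · rw [hf.tail_eq, if_neg (by tauto), if_neg (by tauto)]
      have := hB e he he'
      unfold tailBound at this
      omega

theorem IsFinal.bounded (hc : IsFinal c) {k : ℕ} (hk : k ≤ 2 * m + 1) : Bounded m k c := by
  obtain ⟨x, hx, hr, h⟩ := hc.exists_endgame
  have hB := hx.bounded hr hk
  clear hc hr
  induction h with
  | refl => exact hB
  | tail _ hs ih => exact ih.endStep hk hs

/-- Besides the small chips to the left of `e`, the chip `b` is there too. -/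
theorem tail_lows_add_lt {n : ℕ} {c : Config n} {k : ℕ} (hk : k ≤ n) {e : ℤ} {b : Fin n}
    (hb : k ≤ b.1) (hcb : c b < e) : k + tail univ c e + 1 ≤ n + tail (lows n k) c e := by
  rw [tail_lows_eq hk]
  have : 1 ≤ tail (lows n (n - k)) (reflect c) (1 - e) := by
    unfold tail
    have hmem : b.rev ∈ lows n (n - k) := by
      rw [mem_lows, Fin.val_rev]; omega
    refine le_trans ?_ (single_le_sum (fun j _ => by split_ifs <;> simp) hmem)
    rw [if_pos (by simp [reflect]; omega)]
  omega

theorem one_le_tail {n : ℕ} {S : Finset (Fin n)} {c : Config n} {a : Fin n} (ha : a ∈ S)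
    {e : ℤ} (he : e ≤ c a) : 1 ≤ tail S c e := by
  unfold tail
  refine le_trans ?_ (single_le_sum (fun j _ => by split_ifs <;> simp) ha)
  rw [if_pos he]

/-! ### Sortedness and uniqueness -/

/-- There is no inversion whose left chip is to the left of the origin. -/
theorem IsFinal.le_of_neg (hc : IsFinal c) {a b : Fin (4 * m + 3)} (hab : a < b) (hb : c b < 0) :
    c a ≤ c b := by
  by_contra! hlt
  -- In the final configuration no chip lies to the left of `-m - 1`.
  have hm : -m ≤ c b + 1 := by
    by_contra! hm
    have h1 := tail_lows_add_lt (k := 0) (Nat.zero_le _) (Nat.zero_le b.1) (lt_add_one (c b))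
    have h2 : tail univ c (c b + 1) = 4 * m + 3 := by
      rw [tail_eq_potential_sub]
      have hz1 := hc.rem_eq_zero (c b + 1)
      have hz2 := hc.rem_eq_zero (c b + 1 - 1)
      unfold rem at hz1 hz2
      rw [cap_univ, abs_of_nonpos (by omega), max_eq_right (by omega), max_eq_left (by omega)]
        at hz1 hz2
      linarith
    rw [show lows (4 * m + 3) 0 = ∅ by ext; simp [lows]] at h1
    simp [tail] at h1 h2
    omega
  have hu := tail_univ_eq (c := c) hm (by omega)
  rw [hc.rem_eq_zero, hc.rem_eq_zero] at hu
  -- Put `e = c b + 1`. Exactly `2 * (m + e) + 1` chips end to the left of `e`, `b` among them, so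
  -- at least `k - 2 * (m + e)` of the `k` smallest are at or beyond `e`. With no moves left,
  -- `tailBound` then allows none there. This is absurd: either `a` is one of them, or `k = 2 * m +
  -- 1` and the lower bound is positive because `e ≤ 0`.
  obtain ⟨k, hk, hkb, hka⟩ : ∃ k : ℕ, k ≤ 2 * m + 1 ∧ k ≤ b.1 ∧ (k = 2 * m + 1 ∨ a.1 < k) :=
    ⟨min (a.1 + 1) (2 * m + 1), by omega, by omega, by omega⟩
  have h1 := tail_lows_add_lt (by omega : k ≤ 4 * m + 3) hkb (lt_add_one (c b))
  have h2 := hc.bounded hk (c b + 1) hm (by omega)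
  rw [hc.rem_eq_zero, tailBound] at h2
  rcases hka with hka | hka
  · push_cast at h1
    omega
  · have h3 := one_le_tail (mem_lows.2 hka) (c := c) (e := c b + 1) (by omega)
    push_cast at h1
    omega

theorem IsFinal.weaklySorted (hc : IsFinal c) : WeaklySorted c := by
  intro a b hab
  rcases lt_or_ge (c b) 0 with hb | hb
  · exact hc.le_of_neg hab hb
  · rcases le_or_gt (c a) 0 with ha | ha
    · exact ha.trans hb
    · have := hc.reflect.le_of_neg (Fin.rev_lt_rev.2 hab) (by simpa [SelfLoopChipFiring.reflect])
      simpa [SelfLoopChipFiring.reflect] using this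

/-- In a sorted configuration the chips at or beyond `e` are those of largest label, so the tails
determine every position. -/
theorem WeaklySorted.le_iff {n : ℕ} {c : Config n} (hc : WeaklySorted c) (e : ℤ) (j : Fin n) :
    e ≤ c j ↔ (n : ℤ) - j.1 ≤ tail univ c e := by
  have hmono : Monotone c := monotone_iff_forall_lt.2 fun a b h => hc a b h
  have hcard : tail univ c e = #{x : Fin n | e ≤ c x} := by
    unfold tail; rw [card_filter]; push_cast; rfl
  rw [hcard]
  constructor
  · intro h
    have h1 : Ici j ⊆ ({x : Fin n | e ≤ c x} : Finset (Fin n)) := fun x hx => by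
      simpa using h.trans (hmono (mem_Ici.1 hx))
    have h2 := card_le_card h1
    rw [Fin.card_Ici] at h2
    omega
  · intro h
    by_contra! hlt
    have h1 : ({x : Fin n | e ≤ c x} : Finset (Fin n)) ⊆ Ioi j := fun x hx => by
      rw [mem_Ioi]
      by_contra! hx'
      have := hmono hx'
      have := (mem_filter.1 hx).2
      omega
    have h2 := card_le_card h1
    rw [Fin.card_Ioi] at h2
    have := j.2
    omega

theorem IsFinal.unique (hc : IsFinal c) (hc' : IsFinal c') : c = c' := by
  have ht : ∀ e, tail univ c e = tail univ c' e := by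
    intro e
    have hz := fun i => (hc.rem_eq_zero i).trans (hc'.rem_eq_zero i).symm
    have h1 := hz e
    have h2 := hz (e - 1)
    unfold rem at h1 h2
    rw [tail_eq_potential_sub, tail_eq_potential_sub]
    omega
  have h : ∀ e j, e ≤ c j ↔ e ≤ c' j := fun e j => by
    rw [hc.weaklySorted.le_iff, hc'.weaklySorted.le_iff, ht]
  ext j
  exact le_antisymm ((h _ j).1 le_rfl) ((h _ j).2 le_rfl)

end SelfLoopChipFiring

/-- For `n ≡ 3 (mod 4)` chips at the origin, every maximal sequence of firing moves is finite,
all of them end in one and the same final configuration, and it is weakly sorted. -/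
theorem mainTheorem2 (n : ℕ) (hn : n ≡ 3 [MOD 4]) :
    (¬ ∃ s : ℕ → SelfLoopChipFiring.Config n,
        s 0 = SelfLoopChipFiring.initial n ∧
          ∀ t : ℕ, SelfLoopChipFiring.Fires (s t) (s (t + 1))) ∧
      (∃! c : SelfLoopChipFiring.Config n, SelfLoopChipFiring.IsFinal c) ∧
      (∀ c : SelfLoopChipFiring.Config n, SelfLoopChipFiring.IsFinal c →
        SelfLoopChipFiring.WeaklySorted c) := by
  obtain ⟨m, rfl⟩ : ∃ m, n = 4 * m + 3 := ⟨n / 4, by unfold Nat.ModEq at hn; omega⟩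
  obtain ⟨c, hc⟩ := SelfLoopChipFiring.exists_isFinal m
  exact ⟨SelfLoopChipFiring.not_exists_infinite_run m, ⟨c, hc, fun c' hc' => hc'.unique hc⟩,
    fun c' hc' => hc'.weaklySorted⟩
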